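/- There exists an absolute constant $C>0$ such that the following holds. Let $k, w \ge 1$ be integers and let $G = (L, R, E)$ be a bipartite graph (with vertex set the disjoint union $L \sqcup R$ and every edge joining $L$ to $R$) that is $w$-left-regular (every vertex in $L$ has exactly $w$ neighbors), has no isolated vertices, and is such that no two distinct vertices in $L$ have the same neighborhood. A set of edges $M \subseteq E$ is called an induced matching of $G$ if (i) $M$ is a matching, i.e. no two distinct edges of $M$ share a vertex, and (ii) no edge of $G$ connects endpoints of two distinct edges of $M$. If $G$ has no induced matching of size $k$, then $L$ is finite and \[ |L| \leq \begin{cases} \left(C \cdot \frac{k}{w}\right)^w & \text{if } w \leq k, \\[2pt] \left(C \cdot \frac{w}{k}\right)^k & \text{if } w \geq k. \end{cases} \] -/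

import Mathlib

/-- A set `M` of edges of `G` is an induced matching if (i) distinct edges of `M` share no vertex and
(ii) no edge of `G` connects endpoints of two distinct edges of `M`. -/
def SimpleGraph.IsInducedMatching {V : Type*} (G : SimpleGraph V) (M : Set (Sym2 V)) : Prop :=
  M ⊆ G.edgeSet ∧
    (∀ e ∈ M, ∀ f ∈ M, e ≠ f → ∀ v, v ∈ e → v ∉ f) ∧
    (∀ e ∈ M, ∀ f ∈ M, e ≠ f → ∀ u ∈ e, ∀ v ∈ f, ¬ G.Adj u v)

/-!
For `v ∈ L` with neighbourhood `A`, let `B` be a minimal set that avoids `A` and meets the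
neighbourhood of every other vertex of `L`. By minimality each `x ∈ B` has a neighbour in `L` that
is adjacent to no other point of `B`, so `B` is one side of an induced matching and `|B| < k`. The
pairs `(A, B)` obtained in this way consist of disjoint sets of sizes at most `w` and `k`, while the
set `A` of one pair meets the set `B` of any other. A random set that contains each point
independently with probability `p` contains `A` and misses `B` with probability at least
`p ^ w * (1 - p) ^ k`, and these events exclude each other for different pairs, so there are at most
`1 / (p ^ w * (1 - p) ^ k)` pairs. Take `p = w / (w + k)`.
-/

open Finset

section SetPairs

variable {ι α R : Type*} [CommSemiring R]

lemma sum_Icc_pow_card_mul_pow_card_sdiff [DecidableEq α] {A D U : Finset α} (hAD : A ⊆ D)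
    (hDU : D ⊆ U) (p q : R) :
    ∑ S ∈ Icc A D, p ^ #S * q ^ #(U \ S) = p ^ #A * q ^ #(U \ D) * (p + q) ^ #(D \ A) := by
  have union_injOn : Set.InjOn (A ∪ ·) ((D \ A).powerset : Set (Finset α)) := by
    intro S hS T hT h
    have hS' : Disjoint S A := disjoint_of_subset_left (mem_powerset.1 hS) sdiff_disjoint
    have hT' : Disjoint T A := disjoint_of_subset_left (mem_powerset.1 hT) sdiff_disjoint
    rw [← union_sdiff_cancel_left hS'.symm, ← union_sdiff_cancel_left hT'.symm]
    exact congrArg (· \ A) h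
  rw [Icc_eq_image_powerset hAD, sum_image union_injOn, ← sum_pow_mul_eq_add_pow, mul_sum]
  refine sum_congr rfl fun S hS => ?_
  have hSD : S ⊆ D \ A := mem_powerset.1 hS
  have card_union : #(A ∪ S) = #A + #S :=
    card_union_of_disjoint (disjoint_of_subset_right hSD disjoint_sdiff)
  have card_compl : #(U \ (A ∪ S)) = #(U \ D) + (#(D \ A) - #S) := by
    have hSD' := card_le_card hSD
    have hAD' := card_le_card hAD
    have hDU' := card_le_card hDU
    rw [card_sdiff_of_subset hAD] at hSD' ⊢
    rw [card_sdiff_of_subset hDU,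
      card_sdiff_of_subset (union_subset (hAD.trans hDU) (hSD.trans (sdiff_subset.trans hDU))),
      card_union]
    omega
  rw [card_union, card_compl, pow_add, pow_add]
  ring

variable [PartialOrder R] [IsOrderedRing R]

/-- Tuza's inequality. The sets that contain `A i` and avoid `B i` form an interval of the powerset,
of total weight `p ^ #(A i) * q ^ #(B i)`, and these intervals are disjoint. -/
theorem sum_pow_card_mul_pow_card_le_one {s : Finset ι} {A B : ι → Finset α} {p q : R}
    (hp : 0 ≤ p) (hq : 0 ≤ q) (hpq : p + q = 1) (hdisj : ∀ i ∈ s, Disjoint (A i) (B i))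
    (hcross : (s : Set ι).Pairwise fun i j => ¬ Disjoint (A i) (B j) ∨ ¬ Disjoint (A j) (B i)) :
    ∑ i ∈ s, p ^ #(A i) * q ^ #(B i) ≤ 1 := by
  classical
  set U : Finset α := s.biUnion fun i => A i ∪ B i
  have hU : ∀ i ∈ s, A i ∪ B i ⊆ U := fun i hi => subset_biUnion_of_mem (fun i => A i ∪ B i) hi
  have interval_disjoint :
      (s : Set ι).PairwiseDisjoint fun i => Icc (A i) (U \ B i) := by
    intro i hi j hj hij
    refine disjoint_left.2 fun S hSi hSj => ?_
    rw [mem_Icc, subset_sdiff] at hSi hSj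
    exact (hcross hi hj hij).elim (· (hSj.2.2.mono_left hSi.1)) (· (hSi.2.2.mono_left hSj.1))
  have interval_weight : ∀ i ∈ s,
      ∑ S ∈ Icc (A i) (U \ B i), p ^ #S * q ^ #(U \ S) = p ^ #(A i) * q ^ #(B i) := by
    intro i hi
    obtain ⟨hAU, hBU⟩ := union_subset_iff.1 (hU i hi)
    rw [sum_Icc_pow_card_mul_pow_card_sdiff (subset_sdiff.2 ⟨hAU, hdisj i hi⟩) sdiff_subset,
      Finset.sdiff_sdiff_eq_self hBU, hpq, one_pow, mul_one]
  calc ∑ i ∈ s, p ^ #(A i) * q ^ #(B i)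
      = ∑ S ∈ s.biUnion fun i => Icc (A i) (U \ B i), p ^ #S * q ^ #(U \ S) := by
        rw [sum_biUnion interval_disjoint, sum_congr rfl interval_weight]
    _ ≤ ∑ S ∈ Icc ∅ U, p ^ #S * q ^ #(U \ S) := by
        refine sum_le_sum_of_subset_of_nonneg ?_ fun S _ _ => by positivity
        exact biUnion_subset.2 fun i _ => Icc_subset_Icc (empty_subset _) sdiff_subset
    _ = 1 := by simp [sum_Icc_pow_card_mul_pow_card_sdiff (empty_subset U) Subset.rfl, hpq]

end SetPairs

section Irredundant

variable {ι α : Type*} [DecidableEq α]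

/-- `B` is irredundant for the family `A` if every point of `B` has a private member of `A`, one
that meets `B` in this point only. When the `A i` are the neighbourhoods of the vertices on one side
of a bipartite graph, this makes `B` the other side of an induced matching. -/
def IsIrredundant (A : ι → Finset α) (B : Finset α) : Prop :=
  ∀ x ∈ B, ∃ i, A i ∩ B = {x}

lemma IsIrredundant.mono {A : ι → Finset α} {B C : Finset α} (hC : IsIrredundant A C)
    (hBC : B ⊆ C) : IsIrredundant A B := by
  intro x hx
  obtain ⟨i, hi⟩ := hC x (hBC hx)
  refine ⟨i, ?_⟩
  rw [← inter_eq_right.2 hBC, ← inter_assoc, hi, singleton_inter_of_mem hx]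

lemma exists_isIrredundant_transversal {A : ι → Finset α} {U : Finset α}
    (hU : ∀ i, ¬ Disjoint (A i) U) :
    ∃ B ⊆ U, (∀ i, ¬ Disjoint (A i) B) ∧ IsIrredundant A B := by
  obtain ⟨B, hBU, hB⟩ := exists_minimal_le_of_wellFoundedLT
    (fun B : Finset α => ∀ i, ¬ Disjoint (A i) B) U hU
  refine ⟨B, hBU, hB.prop, fun x hx => ?_⟩
  obtain ⟨i, hi⟩ : ∃ i, Disjoint (A i) (B.erase x) := by
    simpa only [not_forall, not_not] using hB.not_prop_of_lt (erase_ssubset hx)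
  have hsub : A i ∩ B ⊆ {x} := by
    rw [← sdiff_eq_empty_iff_subset, sdiff_singleton_eq_erase, ← inter_erase,
      ← disjoint_iff_inter_eq_empty]
    exact hi
  exact ⟨i, (subset_singleton_iff.1 hsub).resolve_left
    fun h => hB.prop i (disjoint_iff_inter_eq_empty.2 h)⟩

lemma exists_isIrredundant_disjoint [Finite ι] {A : ι → Finset α}
    (hanti : ∀ i j, A i ⊆ A j → i = j) (i : ι) :
    ∃ B, IsIrredundant A B ∧ Disjoint (A i) B ∧ ∀ j ≠ i, ¬ Disjoint (A j) B := by
  cases nonempty_fintype ι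
  have hU : ∀ j : {j // j ≠ i}, ¬ Disjoint (A j) (univ.biUnion A \ A i) := by
    rintro ⟨j, hji⟩ hdisj
    obtain ⟨x, hxj, hxi⟩ := not_subset.1 (mt (hanti j i) hji)
    exact disjoint_left.1 hdisj hxj
      (mem_sdiff.2 ⟨mem_biUnion.2 ⟨j, mem_univ j, hxj⟩, hxi⟩)
  obtain ⟨B, hBU, hmeet, hirr⟩ := exists_isIrredundant_transversal hU
  refine ⟨B, fun x hx => ?_, disjoint_of_subset_right hBU disjoint_sdiff,
    fun j hji => hmeet ⟨j, hji⟩⟩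
  obtain ⟨j, hj⟩ := hirr x hx
  exact ⟨j, hj⟩

theorem card_mul_pow_mul_pow_le_one_of_isIrredundant_card_le {R : Type*} [CommSemiring R]
    [PartialOrder R] [IsOrderedRing R] [Fintype ι] {A : ι → Finset α} {w k : ℕ} {p q : R}
    (hp : 0 ≤ p) (hq : 0 ≤ q) (hpq : p + q = 1) (hanti : ∀ i j, A i ⊆ A j → i = j)
    (hA : ∀ i, #(A i) ≤ w) (hirr : ∀ B, IsIrredundant A B → #B ≤ k) :
    Fintype.card ι * (p ^ w * q ^ k) ≤ 1 := by
  choose B hB hdisj hmeet using exists_isIrredundant_disjoint hanti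
  have hp1 : p ≤ 1 := hpq ▸ le_add_of_nonneg_right hq
  have hq1 : q ≤ 1 := hpq ▸ le_add_of_nonneg_left hp
  calc Fintype.card ι * (p ^ w * q ^ k) = ∑ _i : ι, p ^ w * q ^ k := by
        rw [sum_const, card_univ, nsmul_eq_mul]
    _ ≤ ∑ i, p ^ #(A i) * q ^ #(B i) := sum_le_sum fun i _ =>
        mul_le_mul (pow_le_pow_of_le_one hp hp1 (hA i))
          (pow_le_pow_of_le_one hq hq1 (hirr _ (hB i))) (by positivity) (by positivity)
    _ ≤ 1 := sum_pow_card_mul_pow_card_le_one hp hq hpq (fun i _ => hdisj i)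
        fun i _ j _ hij => Or.inl (hmeet j i hij)

end Irredundant

section InducedMatching

variable {V : Type*} {G : SimpleGraph V} {L R : Set V}

lemma isInducedMatching_of_not_adj {M : Set (Sym2 V)} (hM : M ⊆ G.edgeSet)
    (hadj : ∀ e ∈ M, ∀ f ∈ M, e ≠ f → ∀ u ∈ e, ∀ v ∈ f, ¬ G.Adj u v) :
    G.IsInducedMatching M := by
  refine ⟨hM, fun e he f hf hef v hve hvf => ?_, hadj⟩
  obtain ⟨u, rfl⟩ := hve
  exact hadj _ he f hf hef u (Sym2.mem_mk_right v u) v hvf (hM he).symm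

lemma exists_isInducedMatching_encard_eq (hG : G.IsBipartiteWith L R) {B : Set V}
    (hB : ∀ x ∈ B, ∃ u ∈ L, G.neighborSet u ∩ B = {x}) :
    ∃ M, G.IsInducedMatching M ∧ M.encard = B.encard := by
  choose! f hfL hfB using hB
  have hadj : ∀ x ∈ B, G.Adj (f x) x := fun x hx => ((hfB x hx).ge rfl).1
  have eq_of_adj : ∀ x ∈ B, ∀ y ∈ B, G.Adj (f x) y → y = x := fun x hx y hy h =>
    (hfB x hx).le ⟨h, hy⟩
  have hBR : ∀ x ∈ B, x ∈ R := fun x hx => hG.mem_of_mem_adj (hfL x hx) (hadj x hx)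
  have hLR : ∀ v ∈ L, v ∉ R := fun _ hv => Set.disjoint_left.1 hG.disjoint hv
  refine ⟨(fun x => s(f x, x)) '' B, isInducedMatching_of_not_adj ?_ ?_, Set.InjOn.encard_image ?_⟩
  · rintro _ ⟨x, hx, rfl⟩
    exact hadj x hx
  · rintro _ ⟨x, hx, rfl⟩ _ ⟨y, hy, rfl⟩ hxy u hu v hv huv
    have hne : x ≠ y := fun h => hxy (h ▸ rfl)
    rcases Sym2.mem_iff.1 hu with rfl | rfl <;> rcases Sym2.mem_iff.1 hv with rfl | rfl
    · exact hLR _ (hfL y hy) (hG.mem_of_mem_adj (hfL x hx) huv)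
    · exact hne (eq_of_adj x hx _ hy huv).symm
    · exact hne (eq_of_adj y hy _ hx huv.symm)
    · exact hLR _ (hG.symm.mem_of_mem_adj (hBR _ hx) huv) (hBR _ hy)
  · intro x hx y hy hxy
    rcases Sym2.eq_iff.1 hxy with ⟨-, h⟩ | ⟨h, -⟩
    · exact h
    · exact absurd (h ▸ hBR y hy) (hLR _ (hfL x hx))

lemma card_lt_of_isIrredundant [DecidableEq V] (hG : G.IsBipartiteWith L R) {k : ℕ}
    (hM : ¬ ∃ M : Set (Sym2 V), G.IsInducedMatching M ∧ M.encard = k) {ι : Type*}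
    {A : ι → Finset V} (hA : ∀ i, ∃ u ∈ L, (A i : Set V) = G.neighborSet u) {B : Finset V}
    (hB : IsIrredundant A B) : #B < k := by
  by_contra! hk
  obtain ⟨C, hCB, rfl⟩ := exists_subset_card_eq hk
  rw [← Set.encard_coe_eq_coe_finsetCard] at hM
  refine hM (exists_isInducedMatching_encard_eq hG fun x hx => ?_)
  obtain ⟨i, hi⟩ := hB.mono hCB x hx
  obtain ⟨u, hu, hAu⟩ := hA i
  exact ⟨u, hu, by rw [← hAu, ← coe_inter, hi, coe_singleton]⟩

theorem card_mul_pow_mul_pow_le_one_of_not_exists_isInducedMatching {K : Type*} [CommSemiring K]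
    [PartialOrder K] [IsOrderedRing K] (hG : G.IsBipartiteWith L R) {k w : ℕ}
    (hdeg : ∀ v ∈ L, (G.neighborSet v).encard ≤ w)
    (hanti : ∀ u ∈ L, ∀ v ∈ L, G.neighborSet u ⊆ G.neighborSet v → u = v)
    (hM : ¬ ∃ M : Set (Sym2 V), G.IsInducedMatching M ∧ M.encard = k)
    {p q : K} (hp : 0 ≤ p) (hq : 0 ≤ q) (hpq : p + q = 1) {T : Finset V} (hT : (T : Set V) ⊆ L) :
    #T * (p ^ w * q ^ k) ≤ 1 := by
  classical
  have hfin : ∀ v : T, (G.neighborSet v).Finite := fun v =>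
    Set.finite_of_encard_le_coe (hdeg v (hT v.2))
  have hA : ∀ v : T, ((hfin v).toFinset : Set V) = G.neighborSet v := fun v => (hfin v).coe_toFinset
  rw [← Fintype.card_coe T]
  refine card_mul_pow_mul_pow_le_one_of_isIrredundant_card_le
    (A := fun v => (hfin v).toFinset) hp hq hpq (fun u v huv => ?_) (fun v => ?_) fun B hB =>
      (card_lt_of_isIrredundant hG hM (fun v : T => ⟨v, hT v.2, hA v⟩) hB).le
  · exact Subtype.ext (hanti u (hT u.2) v (hT v.2) (Set.Finite.toFinset_subset_toFinset.1 huv))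
  · rw [← Nat.cast_le (α := ℕ∞), ← Set.encard_coe_eq_coe_finsetCard, hA]
    exact hdeg v (hT v.2)

end InducedMatching

lemma eq_of_subset_of_encard_eq_coe {α : Type*} {s t : Set α} {n : ℕ} (hs : s.encard = n)
    (ht : t.encard = n) (hst : s ⊆ t) : s = t :=
  (Set.finite_of_encard_eq_coe hs).eq_of_subset_of_encard_le hst (by rw [hs, ht])

lemma finite_and_ncard_le_of_forall_finset_card_le {α : Type*} {s : Set α} {c : ℝ}
    (h : ∀ T : Finset α, (T : Set α) ⊆ s → (#T : ℝ) ≤ c) : s.Finite ∧ (s.ncard : ℝ) ≤ c := by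
  have hfin : s.Finite := by
    by_contra hinf
    obtain ⟨n, hn⟩ := exists_nat_gt c
    obtain ⟨T, hT, rfl⟩ := Set.Infinite.exists_subset_card_eq hinf n
    exact (h T hT).not_gt hn
  refine ⟨hfin, ?_⟩
  rw [Set.ncard_eq_toFinset_card s hfin]
  exact h _ hfin.coe_toFinset.subset

lemma one_add_div_pow_mul_one_add_div_pow_le {a b : ℕ} (ha : 1 ≤ a) (hab : a ≤ b) :
    (1 + (b : ℝ) / a) ^ a * (1 + (a : ℝ) / b) ^ b ≤ (6 * ((b : ℝ) / a)) ^ a := by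
  have ha' : (0 : ℝ) < a := by exact_mod_cast ha
  have hb' : (0 : ℝ) < b := by exact_mod_cast ha.trans hab
  have one_le_ratio : 1 ≤ (b : ℝ) / a := (one_le_div ha').2 (by exact_mod_cast hab)
  have second_factor_le : (1 + (a : ℝ) / b) ^ b ≤ 3 ^ a :=
    calc (1 + (a : ℝ) / b) ^ b ≤ Real.exp a := by
          simpa only [neg_div, sub_neg_eq_add, neg_neg] using
            Real.one_sub_div_pow_le_exp_neg (n := b) (t := -a) (by linarith)
      _ = Real.exp 1 ^ a := (Real.exp_one_pow a).symm
      _ ≤ 3 ^ a := by gcongr; exact Real.exp_one_lt_three.le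
  calc (1 + (b : ℝ) / a) ^ a * (1 + (a : ℝ) / b) ^ b ≤ (2 * (b / a)) ^ a * 3 ^ a := by
        gcongr
        linarith
    _ = (6 * ((b : ℝ) / a)) ^ a := by rw [← mul_pow]; ring

theorem corollary1p5_general {k w : ℕ} (hk : 1 ≤ k) (hw : 1 ≤ w) {V : Type*} {G : SimpleGraph V}
    {L R : Set V} (hG : G.IsBipartiteWith L R) (hdeg : ∀ v ∈ L, (G.neighborSet v).encard ≤ w)
    (hanti : ∀ u ∈ L, ∀ v ∈ L, G.neighborSet u ⊆ G.neighborSet v → u = v)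
    (hM : ¬ ∃ M : Set (Sym2 V), G.IsInducedMatching M ∧ M.encard = k) :
    L.Finite ∧
      (w ≤ k → (L.ncard : ℝ) ≤ (6 * ((k : ℝ) / w)) ^ w) ∧
      (k ≤ w → (L.ncard : ℝ) ≤ (6 * ((w : ℝ) / k)) ^ k) := by
  have : (0 : ℝ) < k := by exact_mod_cast hk
  have : (0 : ℝ) < w := by exact_mod_cast hw
  obtain ⟨hfin, hcard⟩ : L.Finite ∧
      (L.ncard : ℝ) ≤ (1 + (k : ℝ) / w) ^ w * (1 + (w : ℝ) / k) ^ k := by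
    refine finite_and_ncard_le_of_forall_finset_card_le fun T hT => ?_
    have h := card_mul_pow_mul_pow_le_one_of_not_exists_isInducedMatching hG hdeg hanti hM
      (p := (1 + (k : ℝ) / w)⁻¹) (q := (1 + (w : ℝ) / k)⁻¹) (by positivity) (by positivity)
      (by field_simp; ring) hT
    rwa [inv_pow, inv_pow, ← mul_inv, ← div_eq_mul_inv, div_le_one (by positivity)] at h
  refine ⟨hfin, fun hwk => hcard.trans (one_add_div_pow_mul_one_add_div_pow_le hw hwk),
    fun hkw => hcard.trans ?_⟩
  rw [mul_comm]
  exact one_add_div_pow_mul_one_add_div_pow_le hk hkw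

theorem corollary1p5 :
    ∃ C : ℝ, 0 < C ∧
      ∀ (k w : ℕ), 1 ≤ k → 1 ≤ w →
      ∀ (V : Type*) (G : SimpleGraph V) (L R : Set V),
        G.IsBipartiteWith L R → L ∪ R = Set.univ →
        (∀ v ∈ L, (G.neighborSet v).encard = w) →
        (∀ v, ∃ u, G.Adj v u) →
        (∀ u ∈ L, ∀ v ∈ L, G.neighborSet u = G.neighborSet v → u = v) →
        (¬ ∃ M : Set (Sym2 V), G.IsInducedMatching M ∧ M.encard = k) →
        L.Finite ∧
          (w ≤ k → (L.ncard : ℝ) ≤ (C * ((k : ℝ) / (w : ℝ))) ^ w) ∧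
          (k ≤ w → (L.ncard : ℝ) ≤ (C * ((w : ℝ) / (k : ℝ))) ^ k) := by
  exact ⟨6, by norm_num, fun k w hk hw V G L R hG _ hdeg _ hinj hM =>
    corollary1p5_general hk hw hG (fun v hv => (hdeg v hv).le) (fun u hu v hv huv =>
      hinj u hu v hv (eq_of_subset_of_encard_eq_coe (hdeg u hu) (hdeg v hv) huv)) hM⟩
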